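/- Let $S_n$ be the symmetric group on $\{1,\dots,n\}$, let $t_{a,b}\in S_n$ be the transposition interchanging $a\neq b$, and let $\ell(\pi)$ be the length of $\pi\in S_n$ with respect to the standard Coxeter generators $t_{i,i+1}$ $(1\le i<n)$, i.e. the least $k$ such that $\pi$ is a product of $k$ of these generators. The strong Bruhat order on $S_n$ is the partial order that is the reflexive transitive closure of the relations $t_{a,b}\pi<\pi$ for all $\pi\in S_n$ and all transpositions $t_{a,b}$ with $\ell(t_{a,b}\pi)<\ell(\pi)$. For $\pi\in S_n$ let the down degree $d_-(\pi)$ be the number of permutations in $S_n$ that are covered by $\pi$ in the strong Bruhat order, let the up degree $d_+(\pi)$ be the number of permutations in $S_n$ that cover $\pi$ in this order, and let the total degree be $d(\pi)=d_-(\pi)+d_+(\pi)$. Let $E_{\pi\in S_n}$ denote the expectation with respect to the uniform distribution on $S_n$. Then, as $n\to\infty$, $$E_{\pi\in S_n}[d_-(\pi)]=n\ln n+O(n)\qquad\text{and}\qquad E_{\pi\in S_n}[d(\pi)]=2n\ln n+O(n).$$ -/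

import Mathlib

namespace StrongBruhat

open Equiv

/-- `s` is one of the standard Coxeter generators of the symmetric group on `Fin n`:
a transposition of two consecutive letters. -/
def IsSimple {n : ℕ} (s : Perm (Fin n)) : Prop :=
  ∃ a b : Fin n, (a : ℕ) + 1 = (b : ℕ) ∧ s = swap a b

/-- Every permutation is a product of standard Coxeter generators. -/
theorem exists_word {n : ℕ} (π : Perm (Fin n)) :
    ∃ w : List (Perm (Fin n)), (∀ s ∈ w, IsSimple s) ∧ w.prod = π := by
  cases n with
  | zero => exact ⟨[], by simp, Subsingleton.elim _ _⟩
  | succ m =>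
    have h : π ∈ Submonoid.closure (Set.range fun i : Fin m ↦ swap i.castSucc i.succ) := by
      rw [Equiv.Perm.mclosure_swap_castSucc_succ]; trivial
    obtain ⟨w, hw, hp⟩ := Submonoid.exists_list_of_mem_closure h
    refine ⟨w, fun s hs => ?_, hp⟩
    obtain ⟨i, rfl⟩ := hw s hs
    exact ⟨i.castSucc, i.succ, by simp, rfl⟩

/-- The length of `π` with respect to the standard Coxeter generators: the least `k` such that
`π` is a product of `k` of them (the set is never empty, see `exists_word`). -/
noncomputable def length {n : ℕ} (π : Perm (Fin n)) : ℕ :=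
  sInf {k : ℕ | ∃ w : List (Perm (Fin n)), (∀ s ∈ w, IsSimple s) ∧ w.length = k ∧ w.prod = π}

/-- `Step σ π`: `σ = t_{a,b} π` for some transposition `t_{a,b}`, and `σ` is shorter than `π`. -/
def Step {n : ℕ} (σ π : Perm (Fin n)) : Prop :=
  ∃ a b : Fin n, a < b ∧ σ = swap a b * π ∧ length σ < length π

theorem length_le_of_reflTransGen {n : ℕ} {σ π : Perm (Fin n)}
    (h : Relation.ReflTransGen Step σ π) : length σ ≤ length π := by
  induction h with
  | refl => exact le_rfl
  | tail _ hs ih =>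
    obtain ⟨_, _, _, _, hl⟩ := hs
    exact ih.trans hl.le

/-- The strong Bruhat order on the symmetric group on `Fin n`: `σ ≤ π` if and only if `σ` is
obtained from `π` by successive left multiplications by transpositions, each of which decreases
the length. -/
@[reducible] def bruhatOrder (n : ℕ) : PartialOrder (Perm (Fin n)) where
  le := Relation.ReflTransGen Step
  le_refl _ := Relation.ReflTransGen.refl
  le_trans _ _ _ := Relation.ReflTransGen.trans
  le_antisymm σ π h₁ h₂ := by
    rcases Relation.ReflTransGen.cases_tail h₁ with h | ⟨τ, hτ, _, _, _, _, hl⟩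
    · exact h.symm
    · have h₃ := length_le_of_reflTransGen hτ
      have h₄ := length_le_of_reflTransGen h₂
      omega

/-- `π` covers `σ` in the strong Bruhat order. -/
def Covers {n : ℕ} (π σ : Perm (Fin n)) : Prop :=
  @CovBy (Perm (Fin n)) (bruhatOrder n).toLT σ π

/-- The number of permutations that are covered by `π`. -/
noncomputable def downDegree {n : ℕ} (π : Perm (Fin n)) : ℕ :=
  Set.ncard {σ : Perm (Fin n) | Covers π σ}

/-- The number of permutations that cover `π`. -/
noncomputable def upDegree {n : ℕ} (π : Perm (Fin n)) : ℕ :=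
  Set.ncard {σ : Perm (Fin n) | Covers σ π}

/-- The valency of `π` in the Hasse diagram of the strong Bruhat order. -/
noncomputable def totalDegree {n : ℕ} (π : Perm (Fin n)) : ℕ :=
  downDegree π + upDegree π

/-- The expectation of `f` at a uniformly distributed random permutation of `Fin n`. -/
noncomputable def expectation {n : ℕ} (f : Perm (Fin n) → ℕ) : ℝ :=
  (∑ π : Perm (Fin n), (f π : ℝ)) / (n.factorial : ℝ)

end StrongBruhat

namespace StrongBruhat

open Equiv Finset

/-! The length of `π` is the inversion number of `π⁻¹`, where the inverse turns left multiplication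
into right multiplication. Hence `π` covers `swap a b * π`, for `a < b`, exactly when `(a, b)` is an
inversion of `π⁻¹` with no `c` between in both position and value (`covers_iff`). Equivalently, on
`T = Icc a b` the value at `b` immediately precedes the value at `a`. By symmetry this has
probability `1 / #T`: `#T - 1` of the `#T * (#T - 1)` ordered pairs of `T` are adjacent
(`card_mul_card_adjacent`). Summing `1 / (b - a + 1)` gives the exact mean `(n + 1) * H_n - 2 * n`.
Counting covering pairs from either end doubles it for the total degree. -/

/-! ### Length as inversion number -/

/-- Indicator that `σ` reverses the order of `x` and `y`. -/
def discord {n : ℕ} (σ : Perm (Fin n)) (x y : Fin n) : ℕ :=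
  if (x < y ∧ σ y < σ x) ∨ (y < x ∧ σ x < σ y) then 1 else 0

/-- The number of ordered pairs whose order is reversed by `σ`: twice the inversion number. -/
def discordSum {n : ℕ} (σ : Perm (Fin n)) : ℕ := ∑ x, ∑ y, discord σ x y

theorem discord_self {n : ℕ} (σ : Perm (Fin n)) (x : Fin n) : discord σ x x = 0 := by
  simp [discord]

theorem discord_comm {n : ℕ} (σ : Perm (Fin n)) (x y : Fin n) :
    discord σ x y = discord σ y x := by
  simp only [discord, or_comm]

/-- `σ c` lies strictly between `σ b` and `σ a`, and `c` lies strictly between `a` and `b`. -/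
def Between {n : ℕ} (σ : Perm (Fin n)) (a b c : Fin n) : Prop :=
  (a < c ∧ c < b) ∧ σ b < σ c ∧ σ c < σ a

instance {n : ℕ} (σ : Perm (Fin n)) (a b c : Fin n) : Decidable (Between σ a b c) := by
  unfold Between; infer_instance

theorem sum_sum_eq_of_symm {α : Type*} [Fintype α] [DecidableEq α] (w : α → α → ℕ)
    (h0 : ∀ x, w x x = 0) (hs : ∀ x y, w x y = w y x) {a b : α} (hab : a ≠ b) :
    ∑ x, ∑ y, w x y = 2 * w a b + 2 * ∑ c ∈ (univ.erase a).erase b, (w a c + w b c)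
      + ∑ x ∈ (univ.erase a).erase b, ∑ y ∈ (univ.erase a).erase b, w x y := by
  have key : ∀ f : α → ℕ, ∑ x, f x = f a + f b + ∑ x ∈ (univ.erase a).erase b, f x := by
    intro f
    rw [← Finset.add_sum_erase univ f (mem_univ a),
      ← Finset.add_sum_erase (univ.erase a) f (by simp [hab.symm] : b ∈ univ.erase a), add_assoc]
  rw [key]
  simp only [key, sum_add_distrib]
  rw [h0, h0, hs b a, sum_congr rfl fun x _ => hs x a, sum_congr rfl fun x _ => hs x b]
  ring

/-- The pair `{a, b}` loses its inversion. For any other `c`, the pairs `{a, c}` and `{b, c}`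
together lose two inversions if `c` is between and none otherwise. Ordered pairs double these to 2
and 4. -/
theorem discordSum_mul_swap {n : ℕ} (σ : Perm (Fin n)) {a b : Fin n} (hab : a < b)
    (h : σ b < σ a) :
    discordSum (σ * swap a b) + 2
      + 4 * ∑ c ∈ (univ.erase a).erase b, (if Between σ a b c then 1 else 0) = discordSum σ := by
  rw [discordSum, discordSum,
    sum_sum_eq_of_symm _ (discord_self _) (discord_comm _) hab.ne,
    sum_sum_eq_of_symm _ (discord_self σ) (discord_comm σ) hab.ne]
  have hS : ∀ c ∈ (univ.erase a).erase b, (σ * swap a b) c = σ c := by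
    intro c hc
    simp only [mem_erase, mem_univ, and_true] at hc
    simp [swap_apply_of_ne_of_ne hc.2 hc.1]
  have h1 : discord (σ * swap a b) a b = 0 := by
    simp [discord, h.le, hab.le, not_lt.2]
  have h2 : discord σ a b = 1 := by
    simp [discord, h, hab]
  have h3 : ∑ x ∈ (univ.erase a).erase b, ∑ y ∈ (univ.erase a).erase b,
      discord (σ * swap a b) x y
      = ∑ x ∈ (univ.erase a).erase b, ∑ y ∈ (univ.erase a).erase b, discord σ x y := by
    refine sum_congr rfl fun x hx => sum_congr rfl fun y hy => ?_
    simp only [discord, hS x hx, hS y hy]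
  have h4 : ∑ c ∈ (univ.erase a).erase b,
      (discord (σ * swap a b) a c + discord (σ * swap a b) b c)
      + 2 * ∑ c ∈ (univ.erase a).erase b, (if Between σ a b c then 1 else 0)
      = ∑ c ∈ (univ.erase a).erase b, (discord σ a c + discord σ b c) := by
    rw [mul_sum, ← sum_add_distrib]
    refine sum_congr rfl fun c hc => ?_
    have hc' := hS c hc
    simp only [mem_erase, mem_univ, and_true] at hc
    have e1 : σ c ≠ σ a := fun e => hc.2 (σ.injective e)
    have e2 : σ c ≠ σ b := fun e => hc.1 (σ.injective e)
    have ha : (σ * swap a b) a = σ b := by simp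
    have hb : (σ * swap a b) b = σ a := by simp
    simp only [discord, Between, hc', ha, hb]
    rcases lt_or_gt_of_ne hc.1 with p | p <;> rcases lt_or_gt_of_ne hc.2 with q | q <;>
    rcases lt_or_gt_of_ne e1 with r | r <;> rcases lt_or_gt_of_ne e2 with s | s <;>
    simp [p, q, r, s, p.le, q.le, r.le, s.le, not_lt.2] <;> grind
  rw [h1, h2, h3]
  omega

theorem discordSum_mul_swap_lt {n : ℕ} (σ : Perm (Fin n)) {a b : Fin n} (hab : a < b)
    (h : σ b < σ a) : discordSum (σ * swap a b) < discordSum σ := by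
  have := discordSum_mul_swap σ hab h
  omega

theorem lt_discordSum_mul_swap {n : ℕ} (σ : Perm (Fin n)) {a b : Fin n} (hab : a < b)
    (h : σ a < σ b) : discordSum σ < discordSum (σ * swap a b) := by
  have := discordSum_mul_swap_lt (σ * swap a b) hab (by simpa using h)
  simpa [mul_assoc] using this

theorem discordSum_mul_swap_of_not_between {n : ℕ} (σ : Perm (Fin n)) {a b : Fin n} (hab : a < b)
    (h : σ b < σ a) (hc : ∀ c, ¬ Between σ a b c) :
    discordSum (σ * swap a b) + 2 = discordSum σ := by
  have := discordSum_mul_swap σ hab h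
  simpa [hc] using this

theorem not_between_of_succ {n : ℕ} (σ : Perm (Fin n)) {a b : Fin n} (hab : (a : ℕ) + 1 = b)
    (c : Fin n) : ¬ Between σ a b c := by
  rintro ⟨⟨h1, h2⟩, -⟩
  simp only [Fin.lt_def] at h1 h2
  omega

theorem discordSum_mul_simple_le {n : ℕ} (σ s : Perm (Fin n)) (hs : IsSimple s) :
    discordSum (σ * s) ≤ discordSum σ + 2 := by
  obtain ⟨a, b, hab, rfl⟩ := hs
  have hlt : a < b := by simp only [Fin.lt_def]; omega
  rcases lt_or_gt_of_ne (fun e => hlt.ne (σ.injective e) : σ a ≠ σ b) with h | h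
  · have := discordSum_mul_swap_of_not_between (σ * swap a b) hlt (by simpa using h)
      (not_between_of_succ _ hab)
    simp only [mul_assoc, swap_mul_self, mul_one] at this
    omega
  · have := discordSum_mul_swap_lt σ hlt h
    omega

theorem discordSum_one {n : ℕ} : discordSum (1 : Perm (Fin n)) = 0 := by
  simp only [discordSum, discord]
  refine sum_eq_zero fun x _ => sum_eq_zero fun y _ => if_neg ?_
  rintro (⟨h1, h2⟩ | ⟨h1, h2⟩) <;> exact lt_asymm h1 h2

theorem discordSum_inv_prod_le {n : ℕ} (w : List (Perm (Fin n))) (hw : ∀ s ∈ w, IsSimple s) :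
    discordSum w.prod⁻¹ ≤ 2 * w.length := by
  induction w with
  | nil => simp [discordSum_one]
  | cons s w ih =>
    have h1 := ih fun t ht => hw t (List.mem_cons_of_mem _ ht)
    have hs := hw s List.mem_cons_self
    have hi : s⁻¹ = s := by
      obtain ⟨a, b, -, rfl⟩ := hs
      exact swap_inv a b
    have h2 := discordSum_mul_simple_le w.prod⁻¹ s hs
    rw [List.prod_cons, mul_inv_rev, hi, List.length_cons]
    omega

theorem eq_one_of_forall_lt {n : ℕ} (σ : Perm (Fin n))
    (h : ∀ a b : Fin n, (a : ℕ) + 1 = b → σ a < σ b) : σ = 1 := by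
  have hm : StrictMono σ := by
    cases n with
    | zero => intro a; exact a.elim0
    | succ m => exact Fin.strictMono_iff_lt_succ.2 fun i => h _ _ (by simp)
  have h1 := Subsingleton.elim (hm.orderIsoOfSurjective _ σ.surjective) (OrderIso.refl _)
  ext x
  have := congrArg (fun f : Fin n ≃o Fin n => f x) h1
  simpa using congrArg Fin.val this

/-- Bubble sort: exchanging an adjacent descent removes exactly one inversion. The bound `k` only
drives the induction. -/
theorem exists_word_of_discordSum {n : ℕ} (k : ℕ) : ∀ σ : Perm (Fin n), discordSum σ ≤ 2 * k →
    ∃ w : List (Perm (Fin n)), (∀ s ∈ w, IsSimple s) ∧ w.prod = σ⁻¹ ∧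
      2 * w.length = discordSum σ := by
  induction k with
  | zero =>
    intro σ hσ
    refine ⟨[], by simp, ?_, by simp only [List.length_nil]; omega⟩
    rw [List.prod_nil, eq_comm, inv_eq_one]
    refine eq_one_of_forall_lt σ fun a b hab => ?_
    have hlt : a < b := by simp only [Fin.lt_def]; omega
    by_contra hn
    have := discordSum_mul_swap_lt σ hlt
      (lt_of_le_of_ne (not_lt.1 hn) fun e => hlt.ne' (σ.injective e))
    omega
  | succ k ih =>
    intro σ hσ
    by_cases h1 : ∀ a b : Fin n, (a : ℕ) + 1 = b → σ a < σ b
    · rw [eq_one_of_forall_lt σ h1]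
      exact ⟨[], by simp, by simp, by simp [discordSum_one]⟩
    · push Not at h1
      obtain ⟨a, b, hab, hle⟩ := h1
      have hlt : a < b := by simp only [Fin.lt_def]; omega
      have hd := discordSum_mul_swap_of_not_between σ hlt
        (lt_of_le_of_ne hle fun e => hlt.ne' (σ.injective e)) (not_between_of_succ _ hab)
      obtain ⟨w, hw, hp, hl⟩ := ih (σ * swap a b) (by omega)
      refine ⟨swap a b :: w, ?_, ?_, ?_⟩
      · intro s hs
        rcases List.mem_cons.1 hs with rfl | hs
        · exact ⟨a, b, hab, rfl⟩
        · exact hw s hs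
      · rw [List.prod_cons, hp, mul_inv_rev, swap_inv, ← mul_assoc, swap_mul_self, one_mul]
      · rw [List.length_cons]; omega

theorem two_mul_length {n : ℕ} (π : Perm (Fin n)) : 2 * length π = discordSum π⁻¹ := by
  obtain ⟨w, hw, hp, hl⟩ := exists_word_of_discordSum (discordSum π⁻¹) π⁻¹ (by omega)
  rw [inv_inv] at hp
  have h1 : length π ≤ w.length := Nat.sInf_le ⟨w, hw, rfl, hp⟩
  obtain ⟨v, hv, hvl, hvp⟩ := Nat.sInf_mem (s := {k : ℕ | ∃ w : List (Perm (Fin n)),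
    (∀ s ∈ w, IsSimple s) ∧ w.length = k ∧ w.prod = π}) ⟨_, w, hw, rfl, hp⟩
  have h2 := discordSum_inv_prod_le v hv
  rw [hvp, hvl] at h2
  change discordSum π⁻¹ ≤ 2 * length π at h2
  omega

theorem length_swap_mul_lt_iff {n : ℕ} (π : Perm (Fin n)) {a b : Fin n} (hab : a < b) :
    length (swap a b * π) < length π ↔ π⁻¹ b < π⁻¹ a := by
  have h1 := two_mul_length π
  have h2 := two_mul_length (swap a b * π)
  rw [mul_inv_rev, swap_inv] at h2
  constructor
  · intro h
    by_contra hn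
    have := lt_discordSum_mul_swap π⁻¹ hab
      (lt_of_le_of_ne (not_lt.1 hn) fun e => hab.ne (π⁻¹.injective e))
    omega
  · intro h
    have := discordSum_mul_swap_lt π⁻¹ hab h
    omega

/-! ### Covering relations -/

theorem step_swap_mul {n : ℕ} (π : Perm (Fin n)) {a b : Fin n} (hab : a < b)
    (h : π⁻¹ b < π⁻¹ a) : Step (swap a b * π) π :=
  ⟨a, b, hab, rfl, (length_swap_mul_lt_iff π hab).2 h⟩

theorem length_lt_of_transGen {n : ℕ} {σ π : Perm (Fin n)} (h : Relation.TransGen Step σ π) :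
    length σ < length π := by
  induction h with
  | single hs => obtain ⟨_, _, _, _, hl⟩ := hs; exact hl
  | tail _ hs ih => obtain ⟨_, _, _, _, hl⟩ := hs; exact ih.trans hl

theorem bruhatOrder_lt_iff {n : ℕ} {σ π : Perm (Fin n)} :
    (bruhatOrder n).lt σ π ↔ Relation.TransGen Step σ π := by
  constructor
  · intro h
    have h' := (@lt_iff_le_and_ne _ (bruhatOrder n) σ π).1 h
    rcases Relation.reflTransGen_iff_eq_or_transGen.1 (show Relation.ReflTransGen Step σ π from h'.1)
      with e | e
    · exact absurd e.symm h'.2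
    · exact e
  · intro h
    refine (@lt_iff_le_and_ne _ (bruhatOrder n) σ π).2 ⟨h.to_reflTransGen, ?_⟩
    rintro rfl
    exact lt_irrefl _ (length_lt_of_transGen h)

theorem covers_iff {n : ℕ} (π σ : Perm (Fin n)) :
    Covers π σ ↔ ∃ a b : Fin n, a < b ∧ π⁻¹ b < π⁻¹ a ∧ (∀ c, ¬ Between π⁻¹ a b c) ∧
      σ = swap a b * π := by
  have hcov : Covers π σ ↔ Relation.TransGen Step σ π ∧
      ∀ τ, Relation.TransGen Step σ τ → ¬ Relation.TransGen Step τ π := by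
    refine and_congr bruhatOrder_lt_iff ⟨fun h τ h1 h2 => ?_, fun h τ h1 h2 => ?_⟩
    · exact h (bruhatOrder_lt_iff.2 h1) (bruhatOrder_lt_iff.2 h2)
    · exact h τ (bruhatOrder_lt_iff.1 h1) (bruhatOrder_lt_iff.1 h2)
  rw [hcov]
  constructor
  · rintro ⟨h, hno⟩
    obtain ⟨τ, hτ, hs⟩ := Relation.TransGen.tail'_iff.1 h
    rcases Relation.reflTransGen_iff_eq_or_transGen.1 hτ with rfl | hτ
    · obtain ⟨a, b, hab, rfl, hl⟩ := hs
      have hba := (length_swap_mul_lt_iff π hab).1 hl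
      refine ⟨a, b, hab, hba, ?_, rfl⟩
      rintro c ⟨⟨hac, hcb⟩, hbc, hca⟩
      -- A between `c` refines the step into three descents, since `(a c)(a b)(c b) = (a b)`, so it
      -- is not a cover.
      have s1 : Step (swap c b * π) π := step_swap_mul π hcb hbc
      have s2 : Step (swap a b * (swap c b * π)) (swap c b * π) := by
        refine step_swap_mul _ hab ?_
        simpa [mul_inv_rev, swap_apply_of_ne_of_ne hac.ne hab.ne] using hca
      have s3 : Step (swap a c * (swap a b * (swap c b * π))) (swap a b * (swap c b * π)) := by
        refine step_swap_mul _ hac ?_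
        simpa [mul_inv_rev, swap_apply_of_ne_of_ne hac.ne hab.ne,
          swap_apply_of_ne_of_ne hac.ne' hcb.ne] using hbc
      have e : swap a c * (swap a b * (swap c b * π)) = swap a b * π := by
        have : swap a c * (swap a b * swap c b) = swap a b := by
          ext x
          simp only [Perm.mul_apply, swap_apply_def]
          grind
        rw [← mul_assoc (swap a b), ← mul_assoc (swap a c), this]
      rw [e] at s3
      exact hno _ ((Relation.TransGen.single s3).tail s2) (.single s1)
    · exact absurd (.single hs) (hno τ hτ)
  · rintro ⟨a, b, hab, hba, hc, rfl⟩
    refine ⟨.single (step_swap_mul π hab hba), fun τ h1 h2 => ?_⟩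
    -- The length drops by exactly one, leaving no room for `τ`.
    have l1 := length_lt_of_transGen h1
    have l2 := length_lt_of_transGen h2
    have e1 := two_mul_length π
    have e2 := two_mul_length (swap a b * π)
    rw [mul_inv_rev, swap_inv] at e2
    have := discordSum_mul_swap_of_not_between π⁻¹ hab hba hc
    omega

/-! ### Probability of adjacency -/

/-- Among the elements of `T`, the value of `σ` at `y` is the immediate predecessor of its value
at `x`. -/
def Adjacent {n : ℕ} (T : Finset (Fin n)) (σ : Perm (Fin n)) (x y : Fin n) : Prop :=
  σ y < σ x ∧ ∀ c ∈ T, ¬ (σ y < σ c ∧ σ c < σ x)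

instance {n : ℕ} (T : Finset (Fin n)) (σ : Perm (Fin n)) (x y : Fin n) :
    Decidable (Adjacent T σ x y) := by
  unfold Adjacent; infer_instance

/-- Every element of `T` except the one of least value has exactly one predecessor. -/
theorem card_adjacent {n : ℕ} (T : Finset (Fin n)) (hT : T.Nonempty) (σ : Perm (Fin n)) :
    ∑ x ∈ T, ∑ y ∈ T, (if Adjacent T σ x y then 1 else 0) = #T - 1 := by
  obtain ⟨m, hm, hmin⟩ := T.exists_min_image σ hT
  rw [← Finset.add_sum_erase T _ hm]
  have h0 : ∑ y ∈ T, (if Adjacent T σ m y then 1 else 0) = 0 :=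
    sum_eq_zero fun y hy => if_neg fun h => absurd h.1 (not_lt.2 (hmin y hy))
  rw [h0, zero_add, ← card_erase_of_mem hm, card_eq_sum_ones]
  refine sum_congr rfl fun x hx => ?_
  obtain ⟨hxm, hxT⟩ := mem_erase.1 hx
  have hne : (T.filter fun y => σ y < σ x).Nonempty :=
    ⟨m, mem_filter.2 ⟨hm, lt_of_le_of_ne (hmin x hxT) fun e => hxm (σ.injective e).symm⟩⟩
  obtain ⟨z, hz, hmax⟩ := exists_max_image _ σ hne
  obtain ⟨hzT, hzx⟩ := mem_filter.1 hz
  rw [sum_eq_single z, if_pos]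
  · exact ⟨hzx, fun c hc h => absurd h.1 (not_lt.2 (hmax c (mem_filter.2 ⟨hc, h.2⟩)))⟩
  · intro y hy hyz
    refine if_neg fun h => h.2 z hzT ⟨?_, hzx⟩
    exact lt_of_le_of_ne (hmax y (mem_filter.2 ⟨hy, h.1⟩)) fun e => hyz (σ.injective e)
  · exact fun h => absurd hzT h

theorem swap_apply_mem_iff {α : Type*} [DecidableEq α] {T : Finset α} {a b : α} (ha : a ∈ T)
    (hb : b ∈ T) (c : α) : swap a b c ∈ T ↔ c ∈ T := by
  rw [swap_apply_def]
  split_ifs with h1 h2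
  · simp [h1, ha, hb]
  · simp [h2, ha, hb]
  · rfl

theorem exists_perm_of_pair {α : Type*} [DecidableEq α] {T : Finset α} {a b x y : α} (ha : a ∈ T)
    (hb : b ∈ T) (hx : x ∈ T) (hy : y ∈ T) (hab : a ≠ b) (hxy : x ≠ y) :
    ∃ τ : Perm α, τ a = x ∧ τ b = y ∧ ∀ c, τ c ∈ T ↔ c ∈ T := by
  have hz : swap a x b ∈ T := (swap_apply_mem_iff ha hx b).2 hb
  refine ⟨swap (swap a x b) y * swap a x, ?_, by simp, fun c => ?_⟩
  · have h : x ≠ swap a x b := fun e => hab ((swap a x).injective (by simpa using e))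
    simp [swap_apply_of_ne_of_ne h hxy]
  · rw [Perm.mul_apply, swap_apply_mem_iff hz hy, swap_apply_mem_iff ha hx]

/-- Right multiplication by a `τ` preserving `T` and taking `(a, b)` to `(x, y)` is a bijection
between the two events. -/
theorem card_filter_adjacent_congr {n : ℕ} {T : Finset (Fin n)} {a b x y : Fin n} (ha : a ∈ T)
    (hb : b ∈ T) (hx : x ∈ T) (hy : y ∈ T) (hab : a ≠ b) (hxy : x ≠ y) :
    ∑ σ : Perm (Fin n), (if Adjacent T σ x y then 1 else 0)
      = ∑ σ : Perm (Fin n), (if Adjacent T σ a b then 1 else 0) := by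
  obtain ⟨τ, rfl, rfl, hτ⟩ := exists_perm_of_pair ha hb hx hy hab hxy
  refine Fintype.sum_equiv (Equiv.mulRight τ) _ _ fun σ => ?_
  have h : Adjacent T σ (τ a) (τ b) ↔ Adjacent T (σ * τ) a b := by
    refine and_congr Iff.rfl ⟨fun h c hc => h _ ((hτ c).2 hc), fun h c hc => ?_⟩
    have := h (τ⁻¹ c) ((hτ _).1 (by simpa using hc))
    simpa using this
  exact if_congr h rfl rfl

theorem card_mul_card_adjacent {n : ℕ} {T : Finset (Fin n)} {a b : Fin n} (ha : a ∈ T)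
    (hb : b ∈ T) (hab : a ≠ b) :
    #T * ∑ σ : Perm (Fin n), (if Adjacent T σ a b then 1 else 0) = n.factorial := by
  set N := ∑ σ : Perm (Fin n), (if Adjacent T σ a b then 1 else 0) with hN
  have h1 : ∑ x ∈ T, ∑ y ∈ T, ∑ σ : Perm (Fin n), (if Adjacent T σ x y then 1 else 0)
      = #T * ((#T - 1) * N) := by
    rw [← smul_eq_mul, ← sum_const]
    refine sum_congr rfl fun x hx => ?_
    rw [← Finset.add_sum_erase T _ hx, sum_eq_zero fun σ _ => if_neg fun h => lt_irrefl _ h.1,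
      zero_add, ← card_erase_of_mem hx, ← smul_eq_mul, ← sum_const]
    refine sum_congr rfl fun y hy => ?_
    obtain ⟨hyx, hyT⟩ := mem_erase.1 hy
    exact card_filter_adjacent_congr ha hb hx hyT hab hyx.symm
  have h2 : ∑ x ∈ T, ∑ y ∈ T, ∑ σ : Perm (Fin n), (if Adjacent T σ x y then 1 else 0)
      = n.factorial * (#T - 1) := by
    rw [sum_congr rfl fun x _ => sum_comm, sum_comm,
      sum_congr rfl fun σ _ => card_adjacent T ⟨a, ha⟩ σ, sum_const, card_univ,
      Fintype.card_perm, Fintype.card_fin, smul_eq_mul]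
  have h3 : 0 < #T - 1 := by
    have : 1 < #T := one_lt_card.2 ⟨a, ha, b, hb, hab⟩
    omega
  refine Nat.eq_of_mul_eq_mul_right h3 ?_
  rw [← h2, h1]
  ring

theorem adjacent_Icc_iff {n : ℕ} (σ : Perm (Fin n)) {a b : Fin n} :
    Adjacent (Icc a b) σ a b ↔ σ b < σ a ∧ ∀ c, ¬ Between σ a b c := by
  refine and_congr Iff.rfl ⟨fun h c hc => h c (mem_Icc.2 ⟨hc.1.1.le, hc.1.2.le⟩) hc.2,
    fun h c hc hb => h c ⟨⟨?_, ?_⟩, hb⟩⟩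
  · exact lt_of_le_of_ne (mem_Icc.1 hc).1 (by rintro rfl; exact lt_irrefl _ hb.2)
  · exact lt_of_le_of_ne (mem_Icc.1 hc).2 (by rintro rfl; exact lt_irrefl _ hb.1)

theorem swap_eq_swap_of_lt {α : Type*} [LinearOrder α] {a b c d : α} (hab : a < b) (hcd : c < d)
    (h : swap a b = swap c d) : a = c ∧ b = d := by
  have h1 : swap c d a = b := by rw [← h, swap_apply_left]
  rw [swap_apply_def] at h1
  split_ifs at h1 with h2 h3
  · exact ⟨h2, h1.symm⟩
  · subst h3 h1
    exact absurd hab hcd.not_gt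
  · exact absurd h1 hab.ne

/-! ### Degrees and their expectations -/

theorem downDegree_eq_sum {n : ℕ} (π : Perm (Fin n)) :
    downDegree π = ∑ b, ∑ a ∈ Iio b, (if Adjacent (Icc a b) π⁻¹ a b then 1 else 0) := by
  have hset : {σ : Perm (Fin n) | Covers π σ} = ↑(((univ.sigma fun b : Fin n => Iio b).filter
      fun p => Adjacent (Icc p.2 p.1) π⁻¹ p.2 p.1).image fun p => swap p.2 p.1 * π) := by
    ext σ
    simp only [Set.mem_ofPred_eq, covers_iff, coe_image, Set.mem_image, mem_coe, mem_filter,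
      mem_sigma, mem_univ, true_and, mem_Iio, adjacent_Icc_iff]
    constructor
    · rintro ⟨a, b, hab, hba, hc, rfl⟩
      exact ⟨⟨b, a⟩, ⟨hab, hba, hc⟩, rfl⟩
    · rintro ⟨⟨b, a⟩, ⟨hab, hba, hc⟩, rfl⟩
      exact ⟨a, b, hab, hba, hc, rfl⟩
  rw [downDegree, hset, Set.ncard_coe_finset, card_image_of_injOn, card_filter, sum_sigma]
  rintro ⟨b, a⟩ hp ⟨d, c⟩ hq h
  simp only [mem_coe, mem_filter, mem_sigma, mem_univ, true_and, mem_Iio] at hp hq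
  obtain ⟨rfl, rfl⟩ := swap_eq_swap_of_lt hp.1 hq.1 (mul_right_cancel h)
  rfl

theorem sum_upDegree {n : ℕ} :
    ∑ π : Perm (Fin n), upDegree π = ∑ π : Perm (Fin n), downDegree π := by
  classical
  have h := sum_card_bipartiteAbove_eq_sum_card_bipartiteBelow (s := univ) (t := univ)
    (fun σ π : Perm (Fin n) => Covers π σ)
  convert h using 2 with π _ π _
  · rw [upDegree, ← Set.ncard_coe_finset]
    simp [bipartiteAbove]
  · rw [downDegree, ← Set.ncard_coe_finset]
    simp [bipartiteBelow]

theorem expectation_totalDegree (n : ℕ) :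
    expectation (fun π : Perm (Fin n) => totalDegree π)
      = 2 * expectation (fun π : Perm (Fin n) => downDegree π) := by
  have h := congrArg (Nat.cast (R := ℝ)) (sum_upDegree (n := n))
  push_cast at h
  simp only [expectation, totalDegree, Nat.cast_add, sum_add_distrib, h]
  ring

theorem sum_range_harmonic_sub_one (n : ℕ) :
    ∑ b ∈ range n, (harmonic (b + 1) - 1) = (n + 1) * harmonic n - 2 * n := by
  induction n with
  | zero => simp
  | succ n ih =>
    rw [sum_range_succ, ih, harmonic_succ]
    push_cast
    field_simp
    ring

theorem sum_Iio_inv_card_Icc {n : ℕ} (b : Fin n) :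
    ∑ a ∈ Iio b, ((#(Icc a b) : ℚ))⁻¹ = harmonic (b + 1) - 1 := by
  have h1 : ∑ a ∈ Iio b, ((#(Icc a b) : ℚ))⁻¹
      = ∑ a ∈ range b, (((b : ℕ) + 1 - a : ℕ) : ℚ)⁻¹ := by
    simp only [Fin.card_Icc]
    rw [← Nat.Iio_eq_range, ← Fin.map_valEmbedding_Iio, sum_map]
    rfl
  -- Reflection turns the denominators `b + 1 - a` into `2, ..., b + 1`; the missing term 1 is the
  -- excluded `a = b`.
  rw [h1, ← sum_range_reflect, harmonic, sum_range_succ']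
  simp only [zero_add, Nat.cast_one, inv_one, add_sub_cancel_right]
  refine sum_congr rfl fun i hi => ?_
  have := mem_range.1 hi
  congr 2
  omega

theorem expectation_downDegree (n : ℕ) :
    expectation (fun π : Perm (Fin n) => downDegree π)
      = (n + 1) * (harmonic n : ℝ) - 2 * n := by
  have h1 : (((∑ π : Perm (Fin n), downDegree π : ℕ)) : ℚ)
      = n.factorial * ∑ b : Fin n, ∑ a ∈ Iio b, ((#(Icc a b) : ℚ))⁻¹ := by
    rw [mul_sum, sum_congr rfl fun π _ => downDegree_eq_sum π, sum_comm, Nat.cast_sum]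
    refine sum_congr rfl fun b _ => ?_
    rw [mul_sum, sum_comm, Nat.cast_sum]
    refine sum_congr rfl fun a ha => ?_
    have hab := mem_Iio.1 ha
    have hT := card_mul_card_adjacent (T := Icc a b) (left_mem_Icc.2 hab.le)
      (right_mem_Icc.2 hab.le) hab.ne
    rw [Fintype.sum_equiv (Equiv.inv (Perm (Fin n)))
      (fun π => if Adjacent (Icc a b) π⁻¹ a b then 1 else 0)
      (fun σ => if Adjacent (Icc a b) σ a b then 1 else 0) (fun _ => rfl)]
    have hpos : (#(Icc a b) : ℚ) ≠ 0 :=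
      Nat.cast_ne_zero.2 (card_ne_zero_of_mem (left_mem_Icc.2 hab.le))
    rw [eq_mul_inv_iff_mul_eq₀ hpos, ← hT]
    push_cast
    ring
  rw [sum_congr rfl fun b _ => sum_Iio_inv_card_Icc b,
    Fin.sum_univ_eq_sum_range (fun b => harmonic (b + 1) - 1) n, sum_range_harmonic_sub_one] at h1
  have h2 := congrArg (Rat.cast (K := ℝ)) h1
  push_cast at h2
  rw [expectation, h2, mul_div_cancel_left₀]
  exact Nat.cast_ne_zero.2 n.factorial_ne_zero

/-- From `log n ≤ H_n ≤ 1 + log n` and `log n ≤ n - 1`, the difference lies in `[-2 * n, 0]` for `n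
> 0`. -/
theorem abs_expectation_downDegree_sub_le (n : ℕ) :
    |expectation (fun π : Perm (Fin n) => downDegree π) - n * Real.log n| ≤ 2 * n := by
  rcases Nat.eq_zero_or_pos n with rfl | hn
  · simp [expectation_downDegree]
  have hn' : (0 : ℝ) < n := Nat.cast_pos.2 hn
  have h1 := harmonic_le_one_add_log n
  have h2 : Real.log n ≤ harmonic n :=
    (Real.log_le_log hn' (by push_cast; linarith)).trans (log_add_one_le_harmonic n)
  have h3 := Real.log_le_sub_one_of_pos hn'
  have h4 := Real.log_natCast_nonneg n
  rw [expectation_downDegree, abs_le]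
  constructor <;> nlinarith

end StrongBruhat

theorem corollary4p2 :
    (fun n : ℕ => StrongBruhat.expectation
        (fun π : Equiv.Perm (Fin n) => StrongBruhat.downDegree π) - (n : ℝ) * Real.log (n : ℝ))
      =O[Filter.atTop] (fun n : ℕ => (n : ℝ)) ∧
    (fun n : ℕ => StrongBruhat.expectation
        (fun π : Equiv.Perm (Fin n) => StrongBruhat.totalDegree π) - 2 * (n : ℝ) * Real.log (n : ℝ))
      =O[Filter.atTop] (fun n : ℕ => (n : ℝ)) := by
  have h : (fun n : ℕ => StrongBruhat.expectation
        (fun π : Equiv.Perm (Fin n) => StrongBruhat.downDegree π) - (n : ℝ) * Real.log (n : ℝ))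
      =O[Filter.atTop] (fun n : ℕ => (n : ℝ)) := by
    refine Asymptotics.IsBigO.of_bound 2 (Filter.Eventually.of_forall fun n => ?_)
    rw [Real.norm_eq_abs, Real.norm_natCast]
    exact StrongBruhat.abs_expectation_downDegree_sub_le n
  refine ⟨h, (h.const_mul_left 2).congr_left fun n => ?_⟩
  rw [StrongBruhat.expectation_totalDegree]
  ring
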